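/- Let $L=(L_t)_{t\ge 0}$ be a Lévy subordinator, i.e. a real-valued process with $L_0=0$, independent and stationary increments, and almost surely nondecreasing right-continuous paths. A structure function $\Phi:\{0,1\}^n\to\{0,1\}$ is coherent if it is nondecreasing in each component and no component $i$ is irrelevant, i.e. for each $i$ there is $x$ with $\Phi(x|_{x_i=0})\neq\Phi(x|_{x_i=1})$. A mixed coherent system of size $n$ is a random choice $\Phi$ among the coherent structure functions of size $n$; its signature is $s_k=\phi_{n-k+1}-\phi_{n-k}$, $k=1,\dots,n$, where $\phi_j=\binom nj^{-1}\sum_{|x|=j}\mathbb E\,\Phi(x)$. For each $n\ge 1$ let $\Phi^{(n)}$ be a mixed coherent system of size $n$ with signature $s^{(n)}$, and let its component failure times $T^{(n)}=(T^{(n)}_1,\dots,T^{(n)}_n)$, independent of the choice of $\Phi^{(n)}$, have the Lévy-frailty Marshall–Olkin distribution driven by $L$ (the same $L$ for all $n$): $T^{(n)}$ has the law of $\big(\inf\{t\ge 0: L_t>\varepsilon_i\}\big)_{i=1}^n$, where $\varepsilon_1,\dots,\varepsilon_n$ are i.i.d. standard exponential variables independent of $L$ and $\inf\emptyset=\infty$.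 Let $T^{(n)}_{\mathrm{sys}}=\inf\{t\ge 0:\Phi^{(n)}\big((1_{\{T^{(n)}_i>t\}})_{i}\big)=0\}$ be the system failure time. Let $Q_n$ be random variables with $\mathbb P(Q_n=\tfrac{k}{n+1})=s^{(n)}_k$ for $k=1,\dots,n$. Assume (A) $Q_n$ converges in distribution to a random variable $Q$, and (B) $\mathbb E\Big[\frac{1}{\sqrt{Q_n(1-Q_n)}}\Big]=o(\sqrt n)$ as $n\to\infty$, where $Q$ is taken to be independent of $L$. Put $-\log 0=+\infty$ and, for a $[0,\infty]$-valued random variable $B$, let $\tau_B=\inf\{t>0:L_t>B\}$. Then for all $t>0$ $$\limsup_{n\to\infty}\Big|\mathbb P\big(T^{(n)}_{\mathrm{sys}}>t\big)-\mathbb P\big(\tau_{-\log(1-Q)}>t\big)\Big|\le \mathbb P\big(L_t=-\log(1-Q)\big),$$ and the same bound holds with $\mathbb P(L_t<-\log(1-Q))$ in place of $\mathbb P(\tau_{-\log(1-Q)}>t)$. In particular, for every $t>0$ such that $L_t$ or $Q$ has a density, $\mathbb P(T^{(n)}_{\mathrm{sys}}>t)$ converges both to $\mathbb P(\tau_{-\log(1-Q)}>t)$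 and to $\mathbb P(L_t<-\log(1-Q))$. Consequently, if $Q$ has a density, or if $L_t$ has a density for every $t>0$, then $T^{(n)}_{\mathrm{sys}}$ converges in distribution (as $[0,\infty]$-valued random variables) to $\tau_{-\log(1-Q)}$. -/

import Mathlib

open MeasureTheory ProbabilityTheory Filter Asymptotics
open scoped NNReal ENNReal Topology

noncomputable section

/-- A structure function of a system with `n` components: it maps a configuration
(`x i = true` when component `i` is working) to the state of the system
(`true` when the system is working). -/
abbrev StructureFunction (n : ℕ) : Type := (Fin n → Bool) → Bool

/-- A structure function is coherent when it is monotone in every component and has no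
irrelevant component. -/
structure IsCoherent {n : ℕ} (φ : StructureFunction n) : Prop where
  monotone : ∀ (i : Fin n) (x : Fin n → Bool),
    φ (Function.update x i false) ≤ φ (Function.update x i true)
  relevant : ∀ i : Fin n, ∃ x : Fin n → Bool,
    φ (Function.update x i false) ≠ φ (Function.update x i true)

/-- A mixed coherent system of size `n`: a random choice `Φ`, under the probability `μ`,
among the (finitely many) coherent systems of size `n`. -/
structure IsMixedCoherent {n : ℕ} {S : Type*} [MeasurableSpace S]
    (Φ : S → StructureFunction n) (μ : Measure S) : Prop where
  measurable : Measurable Φ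
  coherent : ∀ᵐ ω ∂μ, IsCoherent (Φ ω)

/-- The expected proportion of the configurations with exactly `j` working components
for which the system works. The expectation of the `{0,1}`-valued variable `Φ x` is the
probability that `Φ x` is `true`. -/
def workingProportion {n : ℕ} {S : Type*} [MeasurableSpace S]
    (Φ : S → StructureFunction n) (μ : Measure S) (j : ℕ) : ℝ :=
  (∑ x : Fin n → Bool with (Finset.univ.filter fun i => x i = true).card = j,
    μ.real {ω | Φ ω x = true}) / (n.choose j : ℝ)

/-- The `k`-th entry of the signature, for `k = 1, …, n`. -/
def signature {n : ℕ} {S : Type*} [MeasurableSpace S]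
    (Φ : S → StructureFunction n) (μ : Measure S) (k : ℕ) : ℝ :=
  workingProportion Φ μ (n - k + 1) - workingProportion Φ μ (n - k)

/-- The failure time of a system with structure function `φ` whose components fail at the
times `T i`: the first time `t ≥ 0` at which the configuration of the components that are
still working (those with `t < T i`) does not let the system work (`∞` if there is none). -/
def systemFailureTime {n : ℕ} (φ : StructureFunction n) (T : Fin n → ℝ≥0∞) : ℝ≥0∞ :=
  ⨅ (t : ℝ≥0) (_ : φ (fun i => decide ((t : ℝ≥0∞) < T i)) = false), (t : ℝ≥0∞)

/-- A Lévy subordinator: a real process started at `0`, with independent and stationary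
increments, and almost surely nondecreasing right-continuous paths. (Left limits exist by
monotonicity.) -/
structure IsLevySubordinator {Ω : Type*} [MeasurableSpace Ω]
    (L : ℝ≥0 → Ω → ℝ) (P : Measure Ω) : Prop where
  measurable : ∀ t, Measurable (L t)
  zero : ∀ᵐ ω ∂P, L 0 ω = 0
  indep_increments : HasIndepIncrements L P
  stationary_increments : ∀ s t : ℝ≥0,
    IdentDistrib (fun ω => L (s + t) ω - L s ω) (L t) P P
  monotone_paths : ∀ᵐ ω ∂P, Monotone fun t => L t ω
  rightCts_paths : ∀ᵐ ω ∂P, ∀ t : ℝ≥0, ContinuousWithinAt (fun s => L s ω) (Set.Ici t) t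

/-- `inf {t ≥ 0 : l t > e}`, with `inf ∅ = ∞`: the failure time of a component with trigger
`e` when the subordinator has path `l`. -/
def componentFailureTime (l : ℝ≥0 → ℝ) (e : ℝ) : ℝ≥0∞ :=
  ⨅ (t : ℝ≥0) (_ : e < l t), (t : ℝ≥0∞)

/-- The Lévy-frailty Marshall-Olkin distribution in dimension `n` with underlying
subordinator `L`: the law of `(T_1, …, T_n)` with `T_i = inf {t ≥ 0 : L_t > ε_i}`, where
the triggers `ε_i` are i.i.d. standard exponential and independent of `L`. -/
def lfmoLaw {Ω : Type*} [MeasurableSpace Ω] (L : ℝ≥0 → Ω → ℝ) (P : Measure Ω) (n : ℕ) :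
    Measure (Fin n → ℝ≥0∞) :=
  (P.prod (Measure.pi fun _ : Fin n => expMeasure 1)).map
    fun p i => componentFailureTime (fun t => L t p.1) (p.2 i)

/-- `inf {t > 0 : l t > b}`, with `inf ∅ = ∞`: the first passage time of the path `l`
across the level `b`, which may be infinite. -/
def passageTime (l : ℝ≥0 → ℝ) (b : EReal) : ℝ≥0∞ :=
  ⨅ (t : ℝ≥0) (_ : 0 < t ∧ b < ((l t : ℝ) : EReal)), (t : ℝ≥0∞)

/-- The level `-log (1 - q)` for `q ∈ [0, 1]`, equal to `+∞` at `q = 1`. -/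
def negLogOneSub (q : ℝ) : EReal := -ENNReal.log (ENNReal.ofReal (1 - q))

end

/-!
Write `p = exp (-L t)`. A component works at time `t` exactly when its trigger exceeds `L t`, up to
a null event, so given the path of `L` the components work at time `t` independently with
probability `p` (`measureReal_configuration_lfmoLaw`). Since the structure function is drawn
independently of the failure times, only the number of working components matters, and the survival
probability of the system at `t` is the expectation of the binomial average
`∑ j, n.choose j * p ^ j * (1 - p) ^ (n - j) * φ j`, where `φ j` is the proportion of working
configurations with `j` working components (`measureReal_lt_systemFailureTime`).

Summing the signature gives `φ j = P (Qₙ ≥ 1 - j / (n + 1))`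
(`eq_measureReal_Ici_of_increments`). A binomial variable divided by `n` concentrates at `p`, by
Chebyshev's inequality, so for each fixed `p` the binomial average is asymptotically at most
`P (Q ≥ 1 - p)` and at least `P (Q > 1 - p)` by the portmanteau theorem
(`eventually_binomialAverage_lt`, `eventually_lt_binomialAverage`). Integrating over `p`, by
dominated convergence and the independence of `Q` and `L`, the survival probability at `t` is
asymptotically between the probabilities of `1 - exp (-L t) < Q` and of `1 - exp (-L t) ≤ Q`
(`eventually_integral_binomialAverage`), that is, of `L t < -log (1 - Q)` and of
`L t ≤ -log (1 - Q)`. By right-continuity and monotonicity of the paths, the event that `L` passes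
the level `-log (1 - Q)` after `t` lies between the same two events
(`measureReal_lt_passageTime_mem_Icc`). Both bounds on the upper limit follow, the difference of the
two probabilities being that of `L t = -log (1 - Q)`.

If `L t` or `Q` has a density, this last probability vanishes by independence, and the survival
probabilities converge. Convergence of survival probabilities at all positive times is convergence
in distribution on `[0, ∞]` (`tendsto_probabilityMeasure_of_tendsto_Ioi`).
-/

/-! ### Coherent systems and first passage times -/

theorem IsCoherent.monotone_apply {n : ℕ} {φ : StructureFunction n} (hφ : IsCoherent φ) :
    Monotone φ := by
  classical
  -- change the components in `s` one at a time
  have key : ∀ (s : Finset (Fin n)) (x y : Fin n → Bool), x ≤ y → (∀ i ∉ s, x i = y i) →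
      φ x ≤ φ y := by
    intro s
    induction s using Finset.induction_on with
    | empty =>
      intro x y _ h
      rw [show x = y from funext fun i => h i (by simp)]
    | insert a s ha ih =>
      intro x y hxy h
      refine (ih x (Function.update y a (x a)) ?_ ?_).trans ?_
      · intro i
        by_cases hi : i = a
        · subst hi; simp
        · simpa [hi] using hxy i
      · intro i hi
        by_cases hia : i = a
        · subst hia; simp
        · simpa [hia] using h i (by simp [hia, hi])
      · have h1 := hφ.monotone a y
        have h2 := hxy a
        cases hx : x a <;> cases hy : y a
        · rw [← hy, Function.update_eq_self]
        · exact h1.trans_eq (by rw [← hy, Function.update_eq_self])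
        · rw [hx, hy] at h2
          exact absurd (h2 rfl) Bool.false_ne_true
        · rw [← hy, Function.update_eq_self]
  exact fun x y hxy => key Finset.univ x y hxy (by simp)

theorem IsCoherent.apply_false {n : ℕ} {φ : StructureFunction n} (hφ : IsCoherent φ)
    (hn : 0 < n) : φ (fun _ => false) = false := by
  by_contra h
  rw [Bool.not_eq_false] at h
  have hall : ∀ x, φ x = true := fun x => by
    have := hφ.monotone_apply (show (fun _ => false) ≤ x from fun i => Bool.false_le _)
    rw [h] at this
    exact top_le_iff.1 this
  -- a constant structure function has only irrelevant components
  obtain ⟨x, hx⟩ := hφ.relevant ⟨0, hn⟩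
  exact hx (by rw [hall, hall])

theorem IsCoherent.apply_true {n : ℕ} {φ : StructureFunction n} (hφ : IsCoherent φ)
    (hn : 0 < n) : φ (fun _ => true) = true := by
  by_contra h
  rw [Bool.not_eq_true] at h
  have hall : ∀ x, φ x = false := fun x => by
    have := hφ.monotone_apply (show x ≤ (fun _ => true) from fun i => Bool.le_true _)
    rw [h] at this
    exact le_bot_iff.1 this
  -- a constant structure function has only irrelevant components
  obtain ⟨x, hx⟩ := hφ.relevant ⟨0, hn⟩
  exact hx (by rw [hall, hall])

/-- The configuration of the working components is right-continuous in time, so a system that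
works at time `t` works for a while after `t`. -/
theorem lt_systemFailureTime_iff {n : ℕ} {φ : StructureFunction n} (hφ : Monotone φ)
    (T : Fin n → ℝ≥0∞) (t : ℝ≥0) :
    (t : ℝ≥0∞) < systemFailureTime φ T ↔ φ (fun i => decide ((t : ℝ≥0∞) < T i)) = true := by
  constructor
  · intro h
    by_contra hf
    rw [Bool.not_eq_true] at hf
    exact absurd h (not_lt.2 (iInf₂_le t hf))
  · intro h
    have hev : ∀ᶠ s : ℝ≥0 in 𝓝[>] t, ∀ i, (t : ℝ≥0∞) < T i → (s : ℝ≥0∞) < T i := by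
      rw [eventually_all]
      intro i
      by_cases hi : (t : ℝ≥0∞) < T i
      · have : ∀ᶠ s : ℝ≥0 in 𝓝 t, (s : ℝ≥0∞) < T i :=
          ENNReal.continuous_coe.continuousAt.eventually (gt_mem_nhds hi)
        filter_upwards [nhdsWithin_le_nhds this] with s hs _ using hs
      · exact Eventually.of_forall fun s h => absurd h hi
    obtain ⟨s, hs, hts⟩ := (hev.and self_mem_nhdsWithin).exists
    refine lt_of_lt_of_le (ENNReal.coe_lt_coe.2 hts) (le_iInf₂ fun u hu => ?_)
    by_contra hus
    rw [not_le, ENNReal.coe_lt_coe] at hus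
    have hle : (fun i => decide ((t : ℝ≥0∞) < T i)) ≤ fun i => decide ((u : ℝ≥0∞) < T i) := by
      intro i
      by_cases hi : (t : ℝ≥0∞) < T i
      · have : (u : ℝ≥0∞) < T i := (ENNReal.coe_lt_coe.2 hus).trans (hs i hi)
        simp [hi, this]
      · simp [hi]
    have := hφ hle
    rw [h, hu] at this
    exact absurd this (by decide)

/-- The level `e = l t` is excluded: there, the equivalence fails when `l` stays equal to `e` for a
while after `t`. -/
theorem lt_componentFailureTime_iff {l : ℝ≥0 → ℝ} (hl : Monotone l) {t : ℝ≥0}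
    (hc : ContinuousWithinAt l (Set.Ici t) t) {e : ℝ} (he : e ≠ l t) :
    (t : ℝ≥0∞) < componentFailureTime l e ↔ l t < e := by
  constructor
  · intro h
    by_contra hf
    have he' : e < l t := lt_of_le_of_ne (not_lt.1 hf) he
    exact absurd h (not_lt.2 (iInf₂_le t he'))
  · intro h
    have hev : ∀ᶠ s in 𝓝[>] t, l s < e :=
      (hc.mono Set.Ioi_subset_Ici_self).eventually (gt_mem_nhds h)
    obtain ⟨s, hs, hts⟩ := (hev.and self_mem_nhdsWithin).exists
    refine lt_of_lt_of_le (ENNReal.coe_lt_coe.2 hts) (le_iInf₂ fun u hu => ?_)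
    rw [ENNReal.coe_le_coe]
    exact le_of_lt (hl.reflect_lt (hs.trans hu))

theorem lt_passageTime {l : ℝ≥0 → ℝ} (hl : Monotone l) {t : ℝ≥0}
    (hc : ContinuousWithinAt l (Set.Ici t) t) {b : EReal} (hb : (l t : EReal) < b) :
    (t : ℝ≥0∞) < passageTime l b := by
  have hcont : ContinuousWithinAt (fun s => (l s : EReal)) (Set.Ici t) t :=
    continuous_coe_real_ereal.continuousAt.comp_continuousWithinAt hc
  have hev : ∀ᶠ s in 𝓝[>] t, (l s : EReal) < b :=
    (hcont.mono Set.Ioi_subset_Ici_self).eventually (gt_mem_nhds hb)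
  obtain ⟨s, hs, hts⟩ := (hev.and self_mem_nhdsWithin).exists
  refine lt_of_lt_of_le (ENNReal.coe_lt_coe.2 hts) (le_iInf₂ fun u hu => ?_)
  rw [ENNReal.coe_le_coe]
  exact le_of_lt (hl.reflect_lt (EReal.coe_lt_coe_iff.1 (hs.trans hu.2)))

theorem le_of_lt_passageTime {l : ℝ≥0 → ℝ} {t : ℝ≥0} (ht : 0 < t) {b : EReal}
    (h : (t : ℝ≥0∞) < passageTime l b) : (l t : EReal) ≤ b := by
  by_contra hf
  exact absurd h (not_lt.2 (iInf₂_le t ⟨ht, not_le.1 hf⟩))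

/-- In terms of `1 - exp (-x)`, the comparison of `x` with `-log (1 - q)` needs no convention
for `q` outside `[0, 1)`. -/
theorem coe_lt_negLogOneSub_iff (x q : ℝ) :
    (x : EReal) < negLogOneSub q ↔ 1 - Real.exp (-x) < q := by
  have h : (x : EReal) = -ENNReal.log (ENNReal.ofReal (Real.exp (-x))) := by
    rw [ENNReal.log_ofReal_of_pos (Real.exp_pos _), Real.log_exp]; simp
  rw [h, negLogOneSub, EReal.neg_lt_neg_iff, ENNReal.log_lt_log_iff,
    ENNReal.ofReal_lt_ofReal_iff (Real.exp_pos _)]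
  constructor <;> intro h <;> linarith

theorem coe_eq_negLogOneSub_iff (x q : ℝ) :
    (x : EReal) = negLogOneSub q ↔ 1 - Real.exp (-x) = q := by
  have h : (x : EReal) = -ENNReal.log (ENNReal.ofReal (Real.exp (-x))) := by
    rw [ENNReal.log_ofReal_of_pos (Real.exp_pos _), Real.log_exp]; simp
  rw [h, negLogOneSub, neg_inj, ENNReal.log_injective.eq_iff]
  constructor
  · intro h
    rcases le_or_gt (1 - q) 0 with hq | hq
    · rw [ENNReal.ofReal_of_nonpos hq, ENNReal.ofReal_eq_zero] at h
      exact absurd h (not_le.2 (Real.exp_pos _))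
    · rw [ENNReal.ofReal_eq_ofReal_iff (Real.exp_pos _).le hq.le] at h
      linarith
  · rintro rfl
    congr 1
    ring

/-- A passage time into an increasing family of events is a countable infimum, hence
measurable. -/
theorem aemeasurable_iInf_of_upward {Ω : Type*} [MeasurableSpace Ω] {P : Measure Ω}
    {A : ℝ≥0 → Ω → Prop} (hA : ∀ t, NullMeasurableSet {ω | A t ω} P)
    (hup : ∀ᵐ ω ∂P, ∀ s t, s ≤ t → A s ω → A t ω) :
    AEMeasurable (fun ω => ⨅ (t : ℝ≥0) (_ : A t ω), (t : ℝ≥0∞)) P := by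
  classical
  have h1 : AEMeasurable (fun ω => ⨅ q : ℚ≥0,
      ({ω | A (q : ℝ≥0) ω}ᶜ).indicator (fun _ => (⊤ : ℝ≥0∞)) ω + ((q : ℝ≥0) : ℝ≥0∞)) P :=
    AEMeasurable.iInf fun q =>
      ((aemeasurable_const.indicator₀ (hA _).compl).add aemeasurable_const)
  refine h1.congr ?_
  filter_upwards [hup] with ω hω
  refine le_antisymm (le_iInf₂ fun t ht => ?_) (le_iInf fun q => ?_)
  · refine ENNReal.le_of_forall_pos_le_add fun ε hε _ => ?_
    obtain ⟨q, hq1, hq2⟩ : ∃ q : ℚ≥0, t < (q : ℝ≥0) ∧ (q : ℝ≥0) < t + ε := by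
      obtain ⟨q, hq⟩ := exists_rat_btwn (show (t : ℝ) < t + ε by simpa using hε)
      have hq0 : (0 : ℚ) ≤ q := by
        exact_mod_cast (t.2.trans hq.1.le)
      lift q to ℚ≥0 using hq0
      exact ⟨q, by exact_mod_cast hq.1, by exact_mod_cast hq.2⟩
    refine (iInf_le _ q).trans ?_
    have : A q ω := hω _ _ hq1.le ht
    rw [Set.indicator_of_notMem (by simpa using this), zero_add]
    exact_mod_cast hq2.le
  · by_cases h : A q ω
    · rw [Set.indicator_of_notMem (by simpa using h), zero_add]
      exact iInf₂_le_of_le (q : ℝ≥0) h le_rfl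
    · rw [Set.indicator_of_mem (by simpa using h), top_add]
      exact le_top

/-! ### Weak convergence on the extended half-line -/

/-- On `[0, ∞]`, convergence of the survival functions at every positive real `t` gives weak
convergence. The differences of the half-lines `(t, ∞]`, `∅` and the whole space form a π-system
of neighborhoods. -/
theorem tendsto_probabilityMeasure_of_tendsto_Ioi {ι : Type*} {l : Filter ι}
    [l.IsCountablyGenerated] {ρ : ι → ProbabilityMeasure ℝ≥0∞} {ρ' : ProbabilityMeasure ℝ≥0∞}
    (h : ∀ t : ℝ≥0, 0 < t → Tendsto (fun i => (ρ i : Measure ℝ≥0∞).real (Set.Ioi (t : ℝ≥0∞))) l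
      (𝓝 ((ρ' : Measure ℝ≥0∞).real (Set.Ioi (t : ℝ≥0∞))))) :
    Tendsto ρ l (𝓝 ρ') := by
  let C : Set (Set ℝ≥0∞) := {A | A = ∅ ∨ A = Set.univ ∨ ∃ t : ℝ≥0, 0 < t ∧ A = Set.Ioi (t : ℝ≥0∞)}
  have hCm : ∀ A ∈ C, MeasurableSet A := by
    rintro A (rfl | rfl | ⟨t, -, rfl⟩)
    exacts [.empty, .univ, measurableSet_Ioi]
  have hC : ∀ A ∈ C, ∀ B ∈ C, A ⊆ B ∨ B ⊆ A := by
    rintro A (rfl | rfl | ⟨t, ht, rfl⟩) B (rfl | rfl | ⟨s, hs, rfl⟩)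
    any_goals simp
    exact le_total s t
  have hCi : ∀ A ∈ C, ∀ B ∈ C, A ∩ B ∈ C := by
    intro A hA B hB
    rcases hC A hA B hB with h | h
    · rwa [Set.inter_eq_left.2 h]
    · rwa [Set.inter_eq_right.2 h]
  have hCu : ∀ A ∈ C, ∀ B ∈ C, A ∪ B ∈ C := by
    intro A hA B hB
    rcases hC A hA B hB with h | h
    · rwa [Set.union_eq_right.2 h]
    · rwa [Set.union_eq_left.2 h]
  have hCt : ∀ A ∈ C, Tendsto (fun i => (ρ i : Measure ℝ≥0∞).real A) l
      (𝓝 ((ρ' : Measure ℝ≥0∞).real A)) := by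
    rintro A (rfl | rfl | ⟨t, ht, rfl⟩)
    · simpa using tendsto_const_nhds
    · simpa using tendsto_const_nhds
    · exact h t ht
  let S : Set (Set ℝ≥0∞) := {s | ∃ A ∈ C, ∃ B ∈ C, s = A \ B}
  have hS : IsPiSystem S := by
    rintro _ ⟨A, hA, B, hB, rfl⟩ _ ⟨A', hA', B', hB', rfl⟩ -
    refine ⟨A ∩ A', hCi _ hA _ hA', B ∪ B', hCu _ hB _ hB', ?_⟩
    ext x
    simp only [Set.mem_inter_iff, Set.mem_sdiff, Set.mem_union]
    tauto
  refine hS.tendsto_probabilityMeasure_of_tendsto_of_mem ?_ ?_ ?_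
  · rintro _ ⟨A, hA, B, hB, rfl⟩
    exact (hCm A hA).diff (hCm B hB)
  · intro u hu x hx
    have hux : u ∈ 𝓝 x := hu.mem_nhds hx
    obtain ⟨A, hA, hAx, hAu⟩ : ∃ A ∈ C, A ∈ 𝓝 x ∧ ∀ y ∈ A, y ≤ x → y ∈ u := by
      rcases eq_or_ne x 0 with rfl | hx0
      · refine ⟨Set.univ, by simp [C], univ_mem, fun y _ hy => ?_⟩
        rwa [nonpos_iff_eq_zero.1 hy]
      · obtain ⟨a, hax, ha⟩ := exists_Ioc_subset_of_mem_nhds hux ⟨0, pos_iff_ne_zero.2 hx0⟩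
        obtain ⟨c, hac, hcx⟩ := ENNReal.lt_iff_exists_nnreal_btwn.1 hax
        refine ⟨Set.Ioi c, Or.inr (Or.inr ⟨c, ?_, rfl⟩), Ioi_mem_nhds hcx,
          fun y hy hyx => ha ⟨hac.trans hy, hyx⟩⟩
        exact ENNReal.coe_pos.1 (bot_le.trans_lt hac)
    obtain ⟨B, hB, hBx, hBu⟩ : ∃ B ∈ C, Bᶜ ∈ 𝓝 x ∧ ∀ y ∉ B, x ≤ y → y ∈ u := by
      rcases eq_or_ne x ⊤ with rfl | hx0
      · refine ⟨∅, by simp [C], by simp, fun y _ hy => ?_⟩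
        rwa [top_le_iff.1 hy]
      · obtain ⟨a, hax, ha⟩ := exists_Ico_subset_of_mem_nhds hux ⟨⊤, lt_top_iff_ne_top.2 hx0⟩
        obtain ⟨c, hxc, hca⟩ := ENNReal.lt_iff_exists_nnreal_btwn.1 hax
        refine ⟨Set.Ioi c, Or.inr (Or.inr ⟨c, ?_, rfl⟩), ?_,
          fun y hy hyx => ha ⟨hyx, lt_of_le_of_lt (not_lt.1 hy) hca⟩⟩
        · exact ENNReal.coe_pos.1 (bot_le.trans_lt hxc)
        · rw [Set.compl_Ioi]
          exact Iic_mem_nhds hxc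
    refine ⟨A \ B, ⟨A, hA, B, hB, rfl⟩, inter_mem hAx hBx, fun y hy => ?_⟩
    rcases le_total y x with hyx | hyx
    exacts [hAu y hy.1 hyx, hBu y hy.2 hyx]
  · rintro _ ⟨A, hA, B, hB, rfl⟩
    have key : ∀ ρ : ProbabilityMeasure ℝ≥0∞, ((ρ (A \ B) : ℝ≥0) : ℝ) =
        (ρ : Measure ℝ≥0∞).real A - (ρ : Measure ℝ≥0∞).real (A ∩ B) := by
      intro ρ
      have := measureReal_sdiff_add_inter (μ := (ρ : Measure ℝ≥0∞)) (s := A) (hCm B hB)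
      change (ρ : Measure ℝ≥0∞).real (A \ B) = _
      linarith
    rw [← NNReal.tendsto_coe]
    simp_rw [key]
    exact (hCt A hA).sub (hCt _ (hCi _ hA _ hB))

/-! ### Binomial averages of survival functions -/

/-- A signature determines its cumulative sums: if `a` has increments given by the masses of `ρ` at
the points `k / (n + 1)`, read backwards, then `a j` is the mass of `[1 - j / (n + 1), ∞)`. -/
theorem eq_measureReal_Ici_of_increments {n : ℕ} {ρ : Measure ℝ} [IsProbabilityMeasure ρ]
    {a : ℕ → ℝ} (h0 : a 0 = 0) (h1 : a n = 1)
    (h : ∀ k ∈ Finset.Icc 1 n, ρ.real {(k : ℝ) / ((n : ℝ) + 1)} = a (n - k + 1) - a (n - k))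
    {j : ℕ} (hj : j ≤ n) : a j = ρ.real (Set.Ici (1 - (j : ℝ) / ((n : ℝ) + 1))) := by
  have hn1 : (0 : ℝ) < (n : ℝ) + 1 := by positivity
  -- the atoms, numbered from the right
  let x : ℕ → ℝ := fun i => ((n : ℝ) - i) / ((n : ℝ) + 1)
  have hxinj : Function.Injective x := by
    intro i k hik
    have := (div_left_inj' hn1.ne').1 hik
    exact_mod_cast (sub_right_inj.1 this)
  have hx : ∀ i < n, ρ.real {x i} = a (i + 1) - a i := by
    intro i hi
    have := h (n - i) (Finset.mem_Icc.2 ⟨by omega, by omega⟩)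
    rw [Nat.cast_sub hi.le, show n - (n - i) = i by omega] at this
    exact this
  have hsum : ∀ m ≤ n, ρ.real (x '' (Finset.range m : Set ℕ)) = a m := by
    intro m hm
    rw [← Finset.coe_image, ← sum_measureReal_singleton, Finset.sum_image hxinj.injOn,
      Finset.sum_congr rfl fun i hi => hx i ((Finset.mem_range.1 hi).trans_le hm),
      Finset.sum_range_sub, h0, sub_zero]
  have hae : ∀ᵐ y ∂ρ, y ∈ x '' (Finset.range n : Set ℕ) := by
    have hm : MeasurableSet (x '' (Finset.range n : Set ℕ)) :=
      ((Finset.range n).finite_toSet.image x).measurableSet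
    have := probReal_compl_eq_one_sub (μ := ρ) hm
    rw [hsum n le_rfl, h1, sub_self, measureReal_eq_zero_iff] at this
    exact this
  rw [← hsum j hj]
  refine measureReal_congr ?_
  filter_upwards [hae] with y hy
  obtain ⟨i, hi, rfl⟩ := hy
  refine propext ?_
  change x i ∈ x '' _ ↔ _ ≤ x i
  rw [hxinj.mem_set_image, one_sub_div hn1.ne', div_le_div_iff_of_pos_right hn1]
  simp only [Finset.coe_range, Set.mem_Iio]
  rw [← Nat.succ_le_iff, ← Nat.cast_le (α := ℝ)]
  push_cast
  constructor <;> intro h <;> linarith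

/-- The average of `a j` when `j` is binomial with parameters `n` and `p`. -/
def binomialAverage (n : ℕ) (a : ℕ → ℝ) (p : ℝ) : ℝ :=
  ∑ j ∈ Finset.range (n + 1), (n.choose j : ℝ) * p ^ j * (1 - p) ^ (n - j) * a j

theorem binomialAverage_const {n : ℕ} (c p : ℝ) : binomialAverage n (fun _ => c) p = c := by
  rw [binomialAverage, ← Finset.sum_mul]
  have := add_pow p (1 - p) n
  rw [add_sub_cancel, one_pow] at this
  rw [Finset.sum_congr rfl fun j _ => show (n.choose j : ℝ) * p ^ j * (1 - p) ^ (n - j) =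
    p ^ j * (1 - p) ^ (n - j) * n.choose j by ring, ← this, one_mul]

theorem binomialAverage_mono {n : ℕ} {a b : ℕ → ℝ} (h : ∀ j ≤ n, a j ≤ b j) {p : ℝ}
    (hp : p ∈ Set.Icc (0 : ℝ) 1) : binomialAverage n a p ≤ binomialAverage n b p := by
  refine Finset.sum_le_sum fun j hj => mul_le_mul_of_nonneg_left
    (h j (by simpa [Nat.lt_succ_iff] using hj)) ?_
  have h0 := hp.1
  have h1 : 0 ≤ 1 - p := sub_nonneg.2 hp.2
  positivity

theorem binomialAverage_add {n : ℕ} (a b : ℕ → ℝ) (p : ℝ) :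
    binomialAverage n (fun j => a j + b j) p = binomialAverage n a p + binomialAverage n b p := by
  simp only [binomialAverage, mul_add, Finset.sum_add_distrib]

theorem binomialAverage_const_mul {n : ℕ} (c : ℝ) (a : ℕ → ℝ) (p : ℝ) :
    binomialAverage n (fun j => c * a j) p = c * binomialAverage n a p := by
  simp only [binomialAverage, Finset.mul_sum]
  exact Finset.sum_congr rfl fun j _ => by ring

theorem binomialAverage_sq {n : ℕ} (hn : n ≠ 0) {p : ℝ} (hp : p ∈ Set.Icc (0 : ℝ) 1) :
    binomialAverage n (fun j => (p - j / n) ^ 2) p ≤ 1 / n := by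
  have h := bernstein.variance hn ⟨p, hp⟩
  rw [binomialAverage, Finset.sum_range]
  simp only [bernstein_apply, bernstein.z] at h
  rw [Finset.sum_congr rfl fun j _ => mul_comm _ _, h]
  gcongr
  nlinarith [sq_nonneg p, hp.1, hp.2]

theorem continuous_binomialAverage (n : ℕ) (a : ℕ → ℝ) : Continuous (binomialAverage n a) := by
  unfold binomialAverage
  fun_prop

section Bounds

variable {n : ℕ} {ρ : Measure ℝ} [IsProbabilityMeasure ρ] {a : ℕ → ℝ}

/-- Chebyshev's inequality: the binomial weight of the indices `j` with `j / n > p + δ` is at most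
`1 / (n δ ^ 2)`, and for the other indices `a j` is at most the mass of `[1 - p - δ, ∞)`. -/
theorem binomialAverage_le (hn : n ≠ 0)
    (ha : ∀ j ≤ n, a j = ρ.real (Set.Ici (1 - (j : ℝ) / ((n : ℝ) + 1)))) {p : ℝ}
    (hp : p ∈ Set.Icc (0 : ℝ) 1) {δ : ℝ} (hδ : 0 < δ) :
    binomialAverage n a p ≤ ρ.real (Set.Ici (1 - p - δ)) + (δ ^ 2)⁻¹ * (1 / n) := by
  have hn0 : (0 : ℝ) < n := by exact_mod_cast Nat.pos_of_ne_zero hn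
  calc binomialAverage n a p
      ≤ binomialAverage n (fun j => ρ.real (Set.Ici (1 - p - δ)) +
          (δ ^ 2)⁻¹ * (p - j / n) ^ 2) p := by
        refine binomialAverage_mono (fun j hj => ?_) hp
        rw [ha j hj]
        rcases le_or_gt ((j : ℝ) / n) (p + δ) with hjp | hjp
        · have h1 : (j : ℝ) / ((n : ℝ) + 1) ≤ j / n := by gcongr; linarith
          have : ρ.real (Set.Ici (1 - (j : ℝ) / ((n : ℝ) + 1))) ≤ ρ.real (Set.Ici (1 - p - δ)) :=
            measureReal_mono (Set.Ici_subset_Ici.2 (by linarith))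
          have h2 : 0 ≤ (δ ^ 2)⁻¹ * (p - j / n) ^ 2 := by positivity
          linarith
        · have h1 : 1 ≤ (δ ^ 2)⁻¹ * (p - j / n) ^ 2 := by
            rw [inv_mul_eq_div, one_le_div (by positivity)]
            nlinarith
          have h2 : ρ.real (Set.Ici (1 - (j : ℝ) / ((n : ℝ) + 1))) ≤ 1 := measureReal_le_one
          have h3 : 0 ≤ ρ.real (Set.Ici (1 - p - δ)) := measureReal_nonneg
          linarith
    _ ≤ _ := by
        rw [binomialAverage_add, binomialAverage_const, binomialAverage_const_mul]
        gcongr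
        exact binomialAverage_sq hn hp

/-- Chebyshev's inequality for the indices `j` with `j / n < p - δ`. The second `δ` makes up for the
difference between `j / n` and `j / (n + 1)`. -/
theorem le_binomialAverage (hn : n ≠ 0)
    (ha : ∀ j ≤ n, a j = ρ.real (Set.Ici (1 - (j : ℝ) / ((n : ℝ) + 1)))) {p : ℝ}
    (hp : p ∈ Set.Icc (0 : ℝ) 1) {δ : ℝ} (hδ : 0 < δ) (hnδ : 1 / ((n : ℝ) + 1) ≤ δ) :
    ρ.real (Set.Ioi (1 - p + 2 * δ)) ≤ binomialAverage n a p + (δ ^ 2)⁻¹ * (1 / n) := by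
  have hn0 : (0 : ℝ) < n := by exact_mod_cast Nat.pos_of_ne_zero hn
  calc ρ.real (Set.Ioi (1 - p + 2 * δ))
      = binomialAverage n (fun _ => ρ.real (Set.Ioi (1 - p + 2 * δ))) p :=
        (binomialAverage_const _ _).symm
    _ ≤ binomialAverage n (fun j => a j + (δ ^ 2)⁻¹ * (p - j / n) ^ 2) p := by
        refine binomialAverage_mono (fun j hj => ?_) hp
        rw [ha j hj]
        rcases le_or_gt (p - δ) ((j : ℝ) / n) with hjp | hjp
        · have h1 : (j : ℝ) / n - j / ((n : ℝ) + 1) ≤ 1 / ((n : ℝ) + 1) := by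
            have hj' : (j : ℝ) ≤ n := by exact_mod_cast hj
            rw [show (j : ℝ) / n - j / ((n : ℝ) + 1) = (j / n) / ((n : ℝ) + 1) by
              field_simp; ring]
            gcongr
            exact (div_le_one hn0).2 hj'
          have : ρ.real (Set.Ioi (1 - p + 2 * δ)) ≤
              ρ.real (Set.Ici (1 - (j : ℝ) / ((n : ℝ) + 1))) :=
            measureReal_mono fun y hy => by
              have : 1 - p + 2 * δ < y := hy
              change _ ≤ y
              linarith
          have h2 : 0 ≤ (δ ^ 2)⁻¹ * (p - j / n) ^ 2 := by positivity
          linarith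
        · have h1 : 1 ≤ (δ ^ 2)⁻¹ * (p - j / n) ^ 2 := by
            rw [inv_mul_eq_div, one_le_div (by positivity)]
            nlinarith
          have h2 : ρ.real (Set.Ioi (1 - p + 2 * δ)) ≤ 1 := measureReal_le_one
          have h3 : 0 ≤ ρ.real (Set.Ici (1 - (j : ℝ) / ((n : ℝ) + 1))) := measureReal_nonneg
          linarith
    _ ≤ _ := by
        rw [binomialAverage_add, binomialAverage_const_mul]
        gcongr
        exact binomialAverage_sq hn hp

theorem exists_measureReal_Ici_sub_lt (x : ℝ) {ε : ℝ} (hε : 0 < ε) :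
    ∃ δ > 0, ρ.real (Set.Ici (x - δ)) < ρ.real (Set.Ici x) + ε := by
  have hlim : Tendsto (fun m : ℕ => ρ.real (Set.Ici (x - 1 / ((m : ℝ) + 1)))) atTop
      (𝓝 (ρ.real (⋂ m : ℕ, Set.Ici (x - 1 / ((m : ℝ) + 1))))) := by
    refine (ENNReal.tendsto_toReal (measure_ne_top _ _)).comp (tendsto_measure_iInter_atTop
      (fun m => measurableSet_Ici.nullMeasurableSet) (fun i j hij => ?_) ⟨0, measure_ne_top _ _⟩)
    exact Set.Ici_subset_Ici.2 (sub_le_sub_left (Nat.one_div_le_one_div hij) _)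
  have hI : (⋂ m : ℕ, Set.Ici (x - 1 / ((m : ℝ) + 1))) = Set.Ici x := by
    ext y
    simp only [Set.mem_iInter, Set.mem_Ici]
    refine ⟨fun h => le_of_forall_pos_le_add fun η hη => ?_, fun h m => ?_⟩
    · obtain ⟨m, hm⟩ := exists_nat_one_div_lt hη
      linarith [h m]
    · have : (0 : ℝ) < 1 / ((m : ℝ) + 1) := by positivity
      linarith
  rw [hI] at hlim
  obtain ⟨m, hm⟩ := (hlim.eventually (gt_mem_nhds (lt_add_of_pos_right _ hε))).exists
  exact ⟨_, Nat.one_div_pos_of_nat, hm⟩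

theorem exists_lt_measureReal_Ioi_add (x : ℝ) {ε : ℝ} (hε : 0 < ε) :
    ∃ δ > 0, ρ.real (Set.Ioi x) - ε < ρ.real (Set.Ioi (x + 2 * δ)) := by
  have hlim : Tendsto (fun m : ℕ => ρ.real (Set.Ioi (x + 2 * (1 / ((m : ℝ) + 1))))) atTop
      (𝓝 (ρ.real (⋃ m : ℕ, Set.Ioi (x + 2 * (1 / ((m : ℝ) + 1)))))) := by
    refine (ENNReal.tendsto_toReal (measure_ne_top _ _)).comp (tendsto_measure_iUnion_atTop
      (fun i j hij => ?_))
    exact Set.Ioi_subset_Ioi (by linarith [Nat.one_div_le_one_div (α := ℝ) hij])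
  have hI : (⋃ m : ℕ, Set.Ioi (x + 2 * (1 / ((m : ℝ) + 1)))) = Set.Ioi x := by
    ext y
    simp only [Set.mem_iUnion, Set.mem_Ioi]
    refine ⟨fun ⟨m, hm⟩ => ?_, fun h => ?_⟩
    · have : (0 : ℝ) < 1 / ((m : ℝ) + 1) := by positivity
      linarith
    · obtain ⟨m, hm⟩ := exists_nat_one_div_lt (half_pos (sub_pos.2 h))
      exact ⟨m, by linarith⟩
  rw [hI] at hlim
  obtain ⟨m, hm⟩ := (hlim.eventually (lt_mem_nhds (sub_lt_self _ hε))).exists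
  exact ⟨_, Nat.one_div_pos_of_nat, hm⟩

end Bounds

section Limit

variable {ρn : ℕ+ → ProbabilityMeasure ℝ} {ρ' : ProbabilityMeasure ℝ} {b : ℕ+ → ℕ → ℝ}

theorem tendsto_pnat_inv : Tendsto (fun n : ℕ+ => 1 / ((n : ℕ) : ℝ)) atTop (𝓝 0) :=
  tendsto_one_div_atTop_nhds_zero_nat.comp tendsto_PNat_val_atTop_atTop

/-- Pointwise upper bound, by the closed-set half of the portmanteau theorem. -/
theorem eventually_binomialAverage_lt (hρ : Tendsto ρn atTop (𝓝 ρ'))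
    (hb : ∀ n : ℕ+, ∀ j ≤ (n : ℕ),
      b n j = (ρn n : Measure ℝ).real (Set.Ici (1 - (j : ℝ) / (((n : ℕ) : ℝ) + 1))))
    {p : ℝ} (hp : p ∈ Set.Icc (0 : ℝ) 1) {ε : ℝ} (hε : 0 < ε) :
    ∀ᶠ n : ℕ+ in atTop,
      binomialAverage n (b n) p < (ρ' : Measure ℝ).real (Set.Ici (1 - p)) + ε := by
  obtain ⟨δ, hδ, hδε⟩ := exists_measureReal_Ici_sub_lt (ρ := ρ') (1 - p) (half_pos hε)
  have h1 : ∀ᶠ n : ℕ+ in atTop, (ρn n : Measure ℝ).real (Set.Ici (1 - p - δ)) <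
      (ρ' : Measure ℝ).real (Set.Ici (1 - p)) + ε / 2 := by
    have h := ProbabilityMeasure.limsup_measure_closed_le_of_tendsto hρ
      (isClosed_Ici (a := 1 - p - δ))
    have h2 : (ρ' : Measure ℝ) (Set.Ici (1 - p - δ)) <
        ENNReal.ofReal ((ρ' : Measure ℝ).real (Set.Ici (1 - p)) + ε / 2) := by
      rwa [← ofReal_measureReal, ENNReal.ofReal_lt_ofReal_iff (by positivity)]
    filter_upwards [eventually_lt_of_limsup_lt (h.trans_lt h2)] with n hn
    rwa [← ofReal_measureReal, ENNReal.ofReal_lt_ofReal_iff (by positivity)] at hn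
  have h2 : ∀ᶠ n : ℕ+ in atTop, (δ ^ 2)⁻¹ * (1 / ((n : ℕ) : ℝ)) < ε / 2 := by
    have := tendsto_pnat_inv.const_mul (δ ^ 2)⁻¹
    rw [mul_zero] at this
    exact this.eventually (gt_mem_nhds (half_pos hε))
  filter_upwards [h1, h2] with n hn1 hn2
  linarith [binomialAverage_le n.ne_zero (hb n) hp hδ]

/-- Pointwise lower bound, by the open-set half of the portmanteau theorem. -/
theorem eventually_lt_binomialAverage (hρ : Tendsto ρn atTop (𝓝 ρ'))
    (hb : ∀ n : ℕ+, ∀ j ≤ (n : ℕ),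
      b n j = (ρn n : Measure ℝ).real (Set.Ici (1 - (j : ℝ) / (((n : ℕ) : ℝ) + 1))))
    {p : ℝ} (hp : p ∈ Set.Icc (0 : ℝ) 1) {ε : ℝ} (hε : 0 < ε) :
    ∀ᶠ n : ℕ+ in atTop,
      (ρ' : Measure ℝ).real (Set.Ioi (1 - p)) - ε < binomialAverage n (b n) p := by
  obtain ⟨δ, hδ, hδε⟩ := exists_lt_measureReal_Ioi_add (ρ := ρ') (1 - p) (half_pos hε)
  have h1 : ∀ᶠ n : ℕ+ in atTop, (ρ' : Measure ℝ).real (Set.Ioi (1 - p)) - ε / 2 <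
      (ρn n : Measure ℝ).real (Set.Ioi (1 - p + 2 * δ)) := by
    have h := ProbabilityMeasure.le_liminf_measure_open_of_tendsto hρ
      (isOpen_Ioi (a := 1 - p + 2 * δ))
    -- a negative bound is trivial, and has to be set apart because `ENNReal.ofReal` truncates it
    rcases lt_or_ge ((ρ' : Measure ℝ).real (Set.Ioi (1 - p)) - ε / 2) 0 with h0 | h0
    · exact Eventually.of_forall fun n => h0.trans_le measureReal_nonneg
    have h2 : ENNReal.ofReal ((ρ' : Measure ℝ).real (Set.Ioi (1 - p)) - ε / 2) <
        (ρ' : Measure ℝ) (Set.Ioi (1 - p + 2 * δ)) := by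
      rwa [← ofReal_measureReal, ENNReal.ofReal_lt_ofReal_iff_of_nonneg h0]
    filter_upwards [eventually_lt_of_lt_liminf (h2.trans_le h)] with n hn
    rwa [← ofReal_measureReal, ENNReal.ofReal_lt_ofReal_iff_of_nonneg h0] at hn
  have h2 : ∀ᶠ n : ℕ+ in atTop, (δ ^ 2)⁻¹ * (1 / ((n : ℕ) : ℝ)) < ε / 2 := by
    have := tendsto_pnat_inv.const_mul (δ ^ 2)⁻¹
    rw [mul_zero] at this
    exact this.eventually (gt_mem_nhds (half_pos hε))
  have h3 : ∀ᶠ n : ℕ+ in atTop, 1 / (((n : ℕ) : ℝ) + 1) < δ := by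
    filter_upwards [tendsto_pnat_inv.eventually (gt_mem_nhds hδ)] with n hn
    have : (0 : ℝ) < (n : ℕ) := by exact_mod_cast n.pos
    refine lt_of_le_of_lt ?_ hn
    gcongr
    linarith
  filter_upwards [h1, h2, h3] with n hn1 hn2 hn3
  linarith [le_binomialAverage n.ne_zero (hb n) hp hδ hn3.le]

/-- The reverse Fatou lemma for uniformly bounded variables: a pointwise bound for the upper limit
gives a bound for the upper limit of the means. -/
theorem eventually_integral_lt_of_eventually_lt {Ω : Type*} [MeasurableSpace Ω] {P : Measure Ω}
    [IsProbabilityMeasure P] {f : ℕ+ → Ω → ℝ} {g : Ω → ℝ} {C : ℝ}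
    (hf : ∀ n, AEStronglyMeasurable (f n) P) (hg : AEStronglyMeasurable g P)
    (hfC : ∀ n, ∀ᵐ ω ∂P, |f n ω| ≤ C) (hgC : ∀ᵐ ω ∂P, |g ω| ≤ C)
    (h : ∀ᵐ ω ∂P, ∀ ε > 0, ∀ᶠ n in atTop, f n ω < g ω + ε) {ε : ℝ} (hε : 0 < ε) :
    ∀ᶠ n in atTop, ∫ ω, f n ω ∂P < ∫ ω, g ω ∂P + ε := by
  have hfi : ∀ n, Integrable (f n) P := fun n => Integrable.of_bound (hf n) C (hfC n)
  have hgi : Integrable g P := Integrable.of_bound hg C hgC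
  -- the positive parts of the excess tend to zero by dominated convergence
  have hlim : Tendsto (fun n => ∫ ω, max (f n ω - g ω) 0 ∂P) atTop (𝓝 (∫ _, (0 : ℝ) ∂P)) := by
    refine tendsto_integral_filter_of_dominated_convergence (fun _ => 2 * |C|)
      (Eventually.of_forall fun n => ((hfi n).sub hgi).pos_part.aestronglyMeasurable)
      (Eventually.of_forall fun n => ?_) (integrable_const _) ?_
    · filter_upwards [hfC n, hgC] with ω h1 h2
      rw [Real.norm_of_nonneg (le_max_right _ _)]
      refine max_le ?_ (by positivity)
      have := le_abs_self C
      linarith [(abs_le.1 h1).2, (abs_le.1 h2).1]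
    · filter_upwards [h] with ω hω
      rw [Metric.tendsto_nhds]
      intro η hη
      filter_upwards [hω η hη] with n hn
      rw [Real.dist_0_eq_abs, abs_of_nonneg (le_max_right _ _)]
      exact max_lt (by linarith) hη
  rw [integral_zero] at hlim
  filter_upwards [hlim.eventually (gt_mem_nhds hε)] with n hn
  have : ∫ ω, f n ω ∂P - ∫ ω, g ω ∂P ≤ ∫ ω, max (f n ω - g ω) 0 ∂P := by
    rw [← integral_sub (hfi n) hgi]
    exact integral_mono ((hfi n).sub hgi) ((hfi n).sub hgi).pos_part fun ω => le_max_left _ _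
  linarith

end Limit

/-! ### Independence as iterated integration -/

theorem measureReal_mem_eq_integral_of_indepFun {Ω : Type*} [MeasurableSpace Ω] {P : Measure Ω}
    [IsProbabilityMeasure P] {X Y : Ω → ℝ} (hX : AEMeasurable X P) (hY : AEMeasurable Y P)
    (hXY : IndepFun Y X P) {A : Set (ℝ × ℝ)} (hA : MeasurableSet A) :
    P.real {ω | (Y ω, X ω) ∈ A} = ∫ ω, (P.map X).real (Prod.mk (Y ω) ⁻¹' A) ∂P := by
  have := Measure.isProbabilityMeasure_map hX
  have h1 : P {ω | (Y ω, X ω) ∈ A} = ∫⁻ ω, (P.map X) (Prod.mk (Y ω) ⁻¹' A) ∂P := by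
    have h := (indepFun_iff_map_prod_eq_prod_map_map hY hX).1 hXY
    calc P {ω | (Y ω, X ω) ∈ A} = (P.map fun ω => (Y ω, X ω)) A :=
          (Measure.map_apply_of_aemeasurable (hY.prodMk hX) hA).symm
      _ = ∫⁻ y, (P.map X) (Prod.mk y ⁻¹' A) ∂(P.map Y) := by rw [h, Measure.prod_apply hA]
      _ = _ := lintegral_map' (measurable_measure_prodMk_left hA).aemeasurable hY
  rw [measureReal_def, h1, ← integral_toReal]
  · rfl
  · exact (measurable_measure_prodMk_left hA).comp_aemeasurable hY
  · exact Eventually.of_forall fun ω => measure_lt_top _ _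

theorem aestronglyMeasurable_measureReal_section {Ω : Type*} [MeasurableSpace Ω] {P : Measure Ω}
    {ρ : Measure ℝ} [IsProbabilityMeasure ρ] {Y : Ω → ℝ} (hY : AEMeasurable Y P)
    {A : Set (ℝ × ℝ)} (hA : MeasurableSet A) :
    AEStronglyMeasurable (fun ω => ρ.real (Prod.mk (Y ω) ⁻¹' A)) P :=
  ((measurable_measure_prodMk_left hA).ennreal_toReal.comp_aemeasurable hY).aestronglyMeasurable

/-! ### The exponential triggers -/

instance nullSingletonClass_expMeasure (r : ℝ) : NullSingletonClass (expMeasure r) := by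
  unfold expMeasure gammaMeasure
  infer_instance

theorem measure_Ioi_expMeasure_one {x : ℝ} (hx : 0 ≤ x) :
    expMeasure 1 (Set.Ioi x) = ENNReal.ofReal (Real.exp (-x)) := by
  have := isProbabilityMeasure_expMeasure one_pos
  have h := cdf_expMeasure_eq one_pos x
  rw [cdf_eq_real, if_pos hx, one_mul] at h
  rw [← ofReal_measureReal, ← Set.compl_Iic, probReal_compl_eq_one_sub measurableSet_Iic, h,
    sub_sub_cancel]

theorem measure_Iic_expMeasure_one {x : ℝ} (hx : 0 ≤ x) :
    expMeasure 1 (Set.Iic x) = ENNReal.ofReal (1 - Real.exp (-x)) := by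
  have := isProbabilityMeasure_expMeasure one_pos
  have h := cdf_expMeasure_eq one_pos x
  rw [cdf_eq_real, if_pos hx, one_mul] at h
  rw [← ofReal_measureReal, h]

section Subordinator

variable {Ω : Type*} [MeasurableSpace Ω] {P : Measure Ω} {L : ℝ≥0 → Ω → ℝ}

theorem IsLevySubordinator.ae_nonneg (hL : IsLevySubordinator L P) (t : ℝ≥0) :
    ∀ᵐ ω ∂P, 0 ≤ L t ω := by
  filter_upwards [hL.zero, hL.monotone_paths] with ω h0 hm
  rw [← h0]
  exact hm (zero_le)

theorem IsLevySubordinator.ae_exp_mem_Icc (hL : IsLevySubordinator L P) (t : ℝ≥0) :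
    ∀ᵐ ω ∂P, Real.exp (-L t ω) ∈ Set.Icc (0 : ℝ) 1 := by
  filter_upwards [hL.ae_nonneg t] with ω h
  exact ⟨(Real.exp_pos _).le, Real.exp_le_one_iff.2 (by linarith)⟩

theorem aemeasurable_componentFailureTime [IsProbabilityMeasure P]
    (hL : IsLevySubordinator L P) (n : ℕ) :
    AEMeasurable (fun (p : Ω × (Fin n → ℝ)) i => componentFailureTime (fun t => L t p.1) (p.2 i))
      (P.prod (Measure.pi fun _ : Fin n => expMeasure 1)) := by
  have := isProbabilityMeasure_expMeasure one_pos
  refine aemeasurable_pi_lambda _ fun i => ?_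
  refine aemeasurable_iInf_of_upward (fun t => ?_) ?_
  · exact (measurableSet_lt ((measurable_pi_apply i).comp measurable_snd)
      ((hL.measurable t).comp measurable_fst)).nullMeasurableSet
  · filter_upwards [Measure.quasiMeasurePreserving_fst.ae hL.monotone_paths] with p hp s t hst hs
    exact lt_of_lt_of_le hs (hp hst)

/-- The configuration of the components that work at time `t`. -/
noncomputable def configuration {n : ℕ} (t : ℝ≥0) (T : Fin n → ℝ≥0∞) : Fin n → Bool :=
  fun i => decide ((t : ℝ≥0∞) < T i)

theorem measurable_configuration {n : ℕ} (t : ℝ≥0) :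
    Measurable (configuration t : (Fin n → ℝ≥0∞) → Fin n → Bool) := by
  refine measurable_pi_lambda _ fun i => measurable_to_bool ?_
  have : (fun T : Fin n → ℝ≥0∞ => configuration t T i) ⁻¹' {true} = {T | (t : ℝ≥0∞) < T i} := by
    ext T; simp [configuration]
  rw [this]
  exact measurableSet_lt measurable_const (measurable_pi_apply i)

/-- Given `L t`, the components work at time `t` independently, each with probability
`exp (-L t)`. -/
theorem measureReal_configuration_lfmoLaw [IsProbabilityMeasure P]
    (hL : IsLevySubordinator L P) {n : ℕ} (t : ℝ≥0) (x : Fin n → Bool) :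
    (lfmoLaw L P n).real (configuration t ⁻¹' {x}) =
      ∫ ω, Real.exp (-L t ω) ^ (Finset.univ.filter fun i => x i = true).card *
        (1 - Real.exp (-L t ω)) ^ (n - (Finset.univ.filter fun i => x i = true).card) ∂P := by
  have := isProbabilityMeasure_expMeasure one_pos
  set π := Measure.pi fun _ : Fin n => expMeasure 1
  have hset : MeasurableSet (configuration t ⁻¹' {x} : Set (Fin n → ℝ≥0∞)) :=
    measurable_configuration t (measurableSet_singleton x)
  let E : Set (Ω × (Fin n → ℝ)) := {p | ∀ i, L t p.1 < p.2 i ↔ x i = true}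
  have hlt : ∀ i, MeasurableSet {p : Ω × (Fin n → ℝ) | L t p.1 < p.2 i} := fun i =>
    measurableSet_lt ((hL.measurable t).comp measurable_fst)
      ((measurable_pi_apply i).comp measurable_snd)
  have hE : MeasurableSet E := by
    simp only [E, Set.ofPred_forall]
    refine MeasurableSet.iInter fun i => ?_
    cases x i
    · simpa using measurableSet_le ((measurable_pi_apply i).comp measurable_snd)
        ((hL.measurable t).comp measurable_fst)
    · simpa using hlt i
  -- the triggers have no atoms, so none of them equals the independent variable `L t`
  have hne : ∀ᵐ p ∂(P.prod π), ∀ i, p.2 i ≠ L t p.1 := by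
    rw [eventually_all]
    intro i
    have hm : MeasurableSet {p : Ω × (Fin n → ℝ) | p.2 i ≠ L t p.1} :=
      (measurableSet_eq_fun ((measurable_pi_apply i).comp measurable_snd)
        ((hL.measurable t).comp measurable_fst)).compl
    rw [Measure.ae_prod_iff_ae_ae hm]
    refine Eventually.of_forall fun ω => ?_
    rw [ae_iff]
    simpa using Measure.pi_hyperplane (fun _ : Fin n => expMeasure 1) i (L t ω)
  have hEae : (fun (p : Ω × (Fin n → ℝ)) i => componentFailureTime (fun t => L t p.1) (p.2 i)) ⁻¹'
      (configuration t ⁻¹' {x}) =ᵐ[P.prod π] E := by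
    filter_upwards [hne, Measure.quasiMeasurePreserving_fst.ae hL.monotone_paths,
      Measure.quasiMeasurePreserving_fst.ae hL.rightCts_paths] with p h1 h2 h3
    refine propext ?_
    change configuration t _ = x ↔ ∀ i, _
    rw [funext_iff]
    refine forall_congr' fun i => ?_
    rw [← lt_componentFailureTime_iff h2 (h3 t) (h1 i), configuration, Bool.eq_iff_iff,
      decide_eq_true_iff]
  have hsec : ∀ᵐ ω ∂P, π (Prod.mk ω ⁻¹' E) = ENNReal.ofReal
      (Real.exp (-L t ω) ^ (Finset.univ.filter fun i => x i = true).card *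
        (1 - Real.exp (-L t ω)) ^ (n - (Finset.univ.filter fun i => x i = true).card)) := by
    filter_upwards [hL.ae_nonneg t] with ω hω
    have h1 : 0 ≤ 1 - Real.exp (-L t ω) :=
      sub_nonneg.2 (Real.exp_le_one_iff.2 (by linarith))
    have hpi : Prod.mk ω ⁻¹' E = Set.univ.pi fun i =>
        if x i = true then Set.Ioi (L t ω) else Set.Iic (L t ω) := by
      ext y
      simp only [E, Set.mem_preimage, Set.mem_ofPred_eq, Set.mem_univ_pi]
      refine forall_congr' fun i => ?_
      cases x i <;> simp
    rw [hpi, Measure.pi_pi]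
    have : ∀ i, expMeasure 1 (if x i = true then Set.Ioi (L t ω) else Set.Iic (L t ω)) =
        ENNReal.ofReal (if x i = true then Real.exp (-L t ω) else 1 - Real.exp (-L t ω)) := by
      intro i
      split_ifs
      exacts [measure_Ioi_expMeasure_one hω, measure_Iic_expMeasure_one hω]
    rw [Finset.prod_congr rfl fun i _ => this i, ← ENNReal.ofReal_prod_of_nonneg, Finset.prod_ite,
      Finset.prod_const, Finset.prod_const, Finset.filter_not, Finset.card_sdiff_of_subset
        (Finset.filter_subset _ _), Finset.card_univ, Fintype.card_fin]
    intro i _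
    split_ifs
    exacts [(Real.exp_pos _).le, h1]
  rw [measureReal_def, lfmoLaw, Measure.map_apply_of_aemeasurable
    (aemeasurable_componentFailureTime hL n) hset, measure_congr hEae, Measure.prod_apply hE,
    lintegral_congr_ae hsec, ← integral_toReal]
  · refine integral_congr_ae ?_
    filter_upwards [hL.ae_exp_mem_Icc t] with ω hω
    have := sub_nonneg.2 hω.2
    exact ENNReal.toReal_ofReal (by positivity)
  · have := hL.measurable t
    fun_prop
  · exact Eventually.of_forall fun ω => ENNReal.ofReal_lt_top

end Subordinator

/-! ### Mixed coherent systems -/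

section Mixed

variable {n : ℕ} {S : Type*} [MeasurableSpace S] {μ : Measure S} {Φ : S → StructureFunction n}

theorem measurableSet_works (hΦ : Measurable Φ) (x : Fin n → Bool) :
    MeasurableSet {ω | Φ ω x = true} :=
  ((measurable_pi_apply x).comp hΦ) (measurableSet_singleton true)

theorem IsMixedCoherent.workingProportion_zero (hΦ : IsMixedCoherent Φ μ) (hn : 0 < n) :
    workingProportion Φ μ 0 = 0 := by
  rw [workingProportion, Finset.sum_eq_zero, zero_div]
  intro x hx
  simp only [Finset.mem_filter, Finset.mem_univ, true_and, Finset.card_eq_zero,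
    Finset.filter_eq_empty_iff, Bool.not_eq_true, forall_const] at hx
  obtain rfl : x = fun _ => false := funext hx
  rw [measureReal_def, ENNReal.toReal_eq_zero_iff]
  left
  rw [measure_eq_zero_iff_ae_notMem]
  filter_upwards [hΦ.coherent] with ω hω
  simp [hω.apply_false hn]

theorem IsMixedCoherent.workingProportion_self [IsProbabilityMeasure μ]
    (hΦ : IsMixedCoherent Φ μ) (hn : 0 < n) : workingProportion Φ μ n = 1 := by
  have hfil : (Finset.univ.filter fun x : Fin n → Bool =>
      (Finset.univ.filter fun i => x i = true).card = n) = {fun _ => true} := by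
    ext x
    simp only [Finset.mem_filter, Finset.mem_univ, true_and, Finset.mem_singleton, funext_iff]
    have := Finset.card_filter_eq_iff (s := (Finset.univ : Finset (Fin n)))
      (p := fun i => x i = true)
    simpa using this
  rw [workingProportion, hfil, Finset.sum_singleton, Nat.choose_self, Nat.cast_one, div_one]
  have : {ω | Φ ω (fun _ => true) = true} =ᵐ[μ] Set.univ := by
    filter_upwards [hΦ.coherent] with ω hω
    exact propext ⟨fun _ => trivial, fun _ => hω.apply_true hn⟩
  rw [measureReal_congr this, probReal_univ]

theorem ae_systemFailureTime_iff (hΦ : IsMixedCoherent Φ μ) (T : S → Fin n → ℝ≥0∞) :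
    ∀ᵐ ω ∂μ, ∀ t : ℝ≥0, (t : ℝ≥0∞) < systemFailureTime (Φ ω) (T ω) ↔
      Φ ω (configuration t (T ω)) = true := by
  filter_upwards [hΦ.coherent] with ω hω t
  exact lt_systemFailureTime_iff hω.monotone_apply (T ω) t

theorem nullMeasurableSet_works (hΦ : Measurable Φ) {T : S → Fin n → ℝ≥0∞}
    (hT : AEMeasurable T μ) (t : ℝ≥0) :
    NullMeasurableSet {ω | Φ ω (configuration t (T ω)) = true} μ := by
  have hX : AEMeasurable (fun ω => (Φ ω, configuration t (T ω))) μ :=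
    hΦ.aemeasurable.prodMk ((measurable_configuration t).comp_aemeasurable hT)
  exact hX.nullMeasurableSet_preimage (s := {p | p.1 p.2 = true}) (Set.toFinite _).measurableSet

theorem aemeasurable_systemFailureTime (hΦ : IsMixedCoherent Φ μ) {T : S → Fin n → ℝ≥0∞}
    (hT : AEMeasurable T μ) : AEMeasurable (fun ω => systemFailureTime (Φ ω) (T ω)) μ := by
  refine aemeasurable_iInf_of_upward (fun t => ?_) ?_
  · have := (nullMeasurableSet_works hΦ.measurable hT t).compl
    refine this.congr (Eventually.of_forall fun ω => propext ?_)
    exact Bool.eq_false_iff.symm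
  · filter_upwards [hΦ.coherent] with ω hω s t hst hs
    have hle : configuration t (T ω) ≤ configuration s (T ω) := by
      intro i
      simp only [configuration]
      by_cases h : (t : ℝ≥0∞) < T ω i
      · simp [h, lt_of_le_of_lt (ENNReal.coe_le_coe.2 hst) h]
      · simp [h]
    have := hω.monotone_apply hle
    change Φ ω (configuration s (T ω)) = false at hs
    rw [hs] at this
    exact le_bot_iff.1 this

/-- Given `L t`, the number of working components at time `t` is binomial with parameters `n` and
`exp (-L t)`, and the configuration is uniform given that number. -/
theorem measureReal_lt_systemFailureTime {Ω : Type*} [MeasurableSpace Ω] {P : Measure Ω}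
    [IsProbabilityMeasure P] {L : ℝ≥0 → Ω → ℝ} (hL : IsLevySubordinator L P)
    [IsProbabilityMeasure μ] (hΦ : IsMixedCoherent Φ μ) {T : S → Fin n → ℝ≥0∞}
    (hT : HasLaw T (lfmoLaw L P n) μ) (hΦT : IndepFun Φ T μ) (t : ℝ≥0) :
    μ.real {ω | (t : ℝ≥0∞) < systemFailureTime (Φ ω) (T ω)} =
      ∫ ω, binomialAverage n (workingProportion Φ μ) (Real.exp (-L t ω)) ∂P := by
  let c : (Fin n → Bool) → ℕ := fun x => (Finset.univ.filter fun i => x i = true).card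
  have hcn : ∀ x, c x ≤ n := fun x => (Finset.card_filter_le _ _).trans (by simp)
  have hXT : AEMeasurable (fun ω => configuration t (T ω)) μ :=
    (measurable_configuration t).comp_aemeasurable hT.aemeasurable
  have h1 : μ.real {ω | (t : ℝ≥0∞) < systemFailureTime (Φ ω) (T ω)} =
      μ.real (⋃ x ∈ (Finset.univ : Finset (Fin n → Bool)),
        ({ω | Φ ω x = true} ∩ (fun ω => configuration t (T ω)) ⁻¹' {x})) := by
    refine measureReal_congr ?_
    filter_upwards [ae_systemFailureTime_iff hΦ T] with ω hω
    refine propext ((hω t).trans ?_)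
    change _ ↔ ω ∈ ⋃ x ∈ _, _
    simp
  have h2 : ∀ x : Fin n → Bool,
      μ.real ({ω | Φ ω x = true} ∩ (fun ω => configuration t (T ω)) ⁻¹' {x}) =
      ∫ ω, μ.real {ω | Φ ω x = true} *
        (Real.exp (-L t ω) ^ c x * (1 - Real.exp (-L t ω)) ^ (n - c x)) ∂P := by
    intro x
    have hi := (hΦT.comp (measurable_pi_apply x) (measurable_configuration t)
      ).measure_inter_preimage_eq_mul {true} {x} (measurableSet_singleton _)
        (measurableSet_singleton _)
    have hl : μ.real ((fun ω => configuration t (T ω)) ⁻¹' {x}) =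
        (lfmoLaw L P n).real (configuration t ⁻¹' {x}) := by
      rw [← hT.map_eq, measureReal_def, measureReal_def, Measure.map_apply_of_aemeasurable
        hT.aemeasurable (measurable_configuration t (measurableSet_singleton x))]
      rfl
    rw [integral_const_mul, ← measureReal_configuration_lfmoLaw hL t x, ← hl, measureReal_def,
      measureReal_def, measureReal_def, ← ENNReal.toReal_mul]
    exact congrArg ENNReal.toReal hi
  have hint : ∀ x : Fin n → Bool, Integrable (fun ω => μ.real {ω | Φ ω x = true} *
        (Real.exp (-L t ω) ^ c x * (1 - Real.exp (-L t ω)) ^ (n - c x))) P := by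
    intro x
    have hm := hL.measurable t
    refine Integrable.of_bound (by fun_prop) 1 ?_
    filter_upwards [hL.ae_exp_mem_Icc t] with ω hω
    have h0 := hω.1
    have h1 := sub_nonneg.2 hω.2
    rw [Real.norm_of_nonneg (by positivity)]
    refine mul_le_one₀ measureReal_le_one (by positivity) (mul_le_one₀ (pow_le_one₀ h0 hω.2)
      (by positivity) (pow_le_one₀ h1 (by linarith)))
  rw [h1, measureReal_biUnion_finset₀, Finset.sum_congr rfl fun x _ => h2 x,
    ← integral_finsetSum _ fun x _ => hint x]
  · refine integral_congr_ae (Eventually.of_forall fun ω => ?_)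
    simp only [binomialAverage]
    rw [← Finset.sum_fiberwise_of_maps_to (g := c) (t := Finset.range (n + 1))
      (fun x _ => Finset.mem_range.2 (Nat.lt_succ_of_le (hcn x)))]
    refine Finset.sum_congr rfl fun j hj => ?_
    have hC : ((n.choose j : ℕ) : ℝ) ≠ 0 := by
      exact_mod_cast (Nat.choose_pos (Nat.lt_succ_iff.1 (Finset.mem_range.1 hj))).ne'
    rw [workingProportion, Finset.sum_congr rfl fun x hx => by rw [(Finset.mem_filter.1 hx).2],
      ← Finset.sum_mul]
    change (∑ x with c x = j, _) * _ = _ * ((∑ x with c x = j, _) / _)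
    field_simp
  · intro x _ y _ hxy
    refine Disjoint.aedisjoint (Set.disjoint_left.2 fun ω h1 h2 => hxy ?_)
    exact (h1.2 : configuration t (T ω) = x).symm.trans h2.2
  · intro x _
    exact (measurableSet_works hΦ.measurable x).nullMeasurableSet.inter
      (hXT.nullMeasurableSet_preimage (measurableSet_singleton x))

end Mixed

/-! ### The limit of the survival probabilities -/

section Sandwich

variable {Ω : Type*} [MeasurableSpace Ω] {P : Measure Ω}
  {L : ℝ≥0 → Ω → ℝ} {Q : Ω → ℝ}

/-- The upper and lower bounds for binomial averages, integrated against the law of `exp (-L t)`. By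
independence, the integrals of `P (Q ≥ 1 - p)` and `P (Q > 1 - p)` at `p = exp (-L t)` are
probabilities of joint events. -/
theorem eventually_integral_binomialAverage [IsProbabilityMeasure P]
    (hL : IsLevySubordinator L P)
    (hQ : AEMeasurable Q P) (hQL : IndepFun Q (fun ω t => L t ω) P)
    {ρn : ℕ+ → ProbabilityMeasure ℝ} {ρ' : ProbabilityMeasure ℝ} {b : ℕ+ → ℕ → ℝ}
    (hρ : Tendsto ρn atTop (𝓝 ρ')) (hρ' : (ρ' : Measure ℝ) = P.map Q)
    (hb : ∀ n : ℕ+, ∀ j ≤ (n : ℕ),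
      b n j = (ρn n : Measure ℝ).real (Set.Ici (1 - (j : ℝ) / (((n : ℕ) : ℝ) + 1))))
    (t : ℝ≥0) {ε : ℝ} (hε : 0 < ε) :
    ∀ᶠ n : ℕ+ in atTop,
      ∫ ω, binomialAverage n (b n) (Real.exp (-L t ω)) ∂P <
        P.real {ω | 1 - Real.exp (-L t ω) ≤ Q ω} + ε ∧
      P.real {ω | 1 - Real.exp (-L t ω) < Q ω} - ε <
        ∫ ω, binomialAverage n (b n) (Real.exp (-L t ω)) ∂P := by
  have hLt := hL.measurable t
  have hind : IndepFun (L t) Q P := (hQL.comp measurable_id (measurable_pi_apply t)).symm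
  have hA1 : MeasurableSet {p : ℝ × ℝ | 1 - Real.exp (-p.1) ≤ p.2} :=
    measurableSet_le (by fun_prop) (by fun_prop)
  have hA2 : MeasurableSet {p : ℝ × ℝ | 1 - Real.exp (-p.1) < p.2} :=
    measurableSet_lt (by fun_prop) (by fun_prop)
  have e1 : P.real {ω | 1 - Real.exp (-L t ω) ≤ Q ω} =
      ∫ ω, (ρ' : Measure ℝ).real (Set.Ici (1 - Real.exp (-L t ω))) ∂P := by
    rw [hρ']
    exact measureReal_mem_eq_integral_of_indepFun hQ hLt.aemeasurable hind hA1
  have e2 : P.real {ω | 1 - Real.exp (-L t ω) < Q ω} =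
      ∫ ω, (ρ' : Measure ℝ).real (Set.Ioi (1 - Real.exp (-L t ω))) ∂P := by
    rw [hρ']
    exact measureReal_mem_eq_integral_of_indepFun hQ hLt.aemeasurable hind hA2
  have hm1 : AEStronglyMeasurable
      (fun ω => (ρ' : Measure ℝ).real (Set.Ici (1 - Real.exp (-L t ω)))) P :=
    aestronglyMeasurable_measureReal_section (ρ := ρ') hLt.aemeasurable hA1
  have hm2 : AEStronglyMeasurable
      (fun ω => (ρ' : Measure ℝ).real (Set.Ioi (1 - Real.exp (-L t ω)))) P :=
    aestronglyMeasurable_measureReal_section (ρ := ρ') hLt.aemeasurable hA2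
  have hf : ∀ n : ℕ+, AEStronglyMeasurable
      (fun ω => binomialAverage n (b n) (Real.exp (-L t ω))) P := fun n =>
    ((continuous_binomialAverage n (b n)).measurable.comp
      (Real.measurable_exp.comp hLt.neg)).aestronglyMeasurable
  have habs : ∀ {ρ : ProbabilityMeasure ℝ} (s : Set ℝ), |(ρ : Measure ℝ).real s| ≤ 1 :=
    fun s => by rw [abs_of_nonneg measureReal_nonneg]; exact measureReal_le_one
  have hfC : ∀ n : ℕ+, ∀ᵐ ω ∂P, |binomialAverage n (b n) (Real.exp (-L t ω))| ≤ 1 := by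
    intro n
    filter_upwards [hL.ae_exp_mem_Icc t] with ω hω
    rw [abs_le]
    constructor
    · rw [← binomialAverage_const (n := n) (-1) (Real.exp (-L t ω))]
      refine binomialAverage_mono (fun j hj => ?_) hω
      rw [hb n j hj]
      exact (abs_le.1 (habs _)).1
    · rw [← binomialAverage_const (n := n) 1 (Real.exp (-L t ω))]
      refine binomialAverage_mono (fun j hj => ?_) hω
      rw [hb n j hj]
      exact (abs_le.1 (habs _)).2
  have u1 := eventually_integral_lt_of_eventually_lt (C := 1) hf hm1 hfC
    (Eventually.of_forall fun ω => habs _) (by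
      filter_upwards [hL.ae_exp_mem_Icc t] with ω hω ε hε
      exact eventually_binomialAverage_lt hρ hb hω hε) hε
  have u2 := eventually_integral_lt_of_eventually_lt (C := 1)
    (f := fun n ω => -binomialAverage n (b n) (Real.exp (-L t ω)))
    (g := fun ω => -(ρ' : Measure ℝ).real (Set.Ioi (1 - Real.exp (-L t ω))))
    (fun n => (hf n).neg) hm2.neg (fun n => by simpa only [abs_neg] using hfC n)
    (Eventually.of_forall fun ω => by rw [abs_neg]; exact habs _) (by
      filter_upwards [hL.ae_exp_mem_Icc t] with ω hω ε hε
      filter_upwards [eventually_lt_binomialAverage hρ hb hω hε] with n hn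
      linarith) hε
  filter_upwards [u1, u2] with n h1 h2
  rw [integral_neg, integral_neg] at h2
  rw [e1, e2]
  exact ⟨h1, by linarith⟩

theorem negLogOneSub_lt_coe_iff (x q : ℝ) :
    negLogOneSub q < (x : EReal) ↔ q < 1 - Real.exp (-x) := by
  rw [lt_iff_le_and_ne, lt_iff_le_and_ne, ← not_lt, coe_lt_negLogOneSub_iff, not_lt, ne_comm,
    Ne, coe_eq_negLogOneSub_iff, ne_comm]

theorem coe_le_negLogOneSub_iff (x q : ℝ) :
    (x : EReal) ≤ negLogOneSub q ↔ 1 - Real.exp (-x) ≤ q := by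
  rw [← not_lt, negLogOneSub_lt_coe_iff, not_lt]

theorem aemeasurable_passageTime (hL : IsLevySubordinator L P) (hQ : AEMeasurable Q P) :
    AEMeasurable (fun ω => passageTime (fun u => L u ω) (negLogOneSub (Q ω))) P := by
  refine aemeasurable_iInf_of_upward (fun t => ?_) ?_
  · have hLt := hL.measurable t
    simp_rw [negLogOneSub_lt_coe_iff]
    exact (MeasurableSet.const (0 < t)).nullMeasurableSet.inter
      (nullMeasurableSet_lt hQ (by fun_prop))
  · filter_upwards [hL.monotone_paths] with ω hω s t hst hs
    exact ⟨hs.1.trans_le hst, hs.2.trans_le (EReal.coe_le_coe_iff.2 (hω hst))⟩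

/-- The event of passage after `t` lies between `L t < -log (1 - Q)` and `L t ≤ -log (1 - Q)`. -/
theorem measureReal_lt_passageTime_mem_Icc [IsProbabilityMeasure P]
    (hL : IsLevySubordinator L P) {t : ℝ≥0} (ht : 0 < t) :
    P.real {ω | (t : ℝ≥0∞) < passageTime (fun u => L u ω) (negLogOneSub (Q ω))} ∈
      Set.Icc (P.real {ω | ((L t ω : ℝ) : EReal) < negLogOneSub (Q ω)})
        (P.real {ω | ((L t ω : ℝ) : EReal) ≤ negLogOneSub (Q ω)}) := by
  constructor
  · refine ENNReal.toReal_mono (measure_ne_top _ _) (measure_mono_ae ?_)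
    filter_upwards [hL.monotone_paths, hL.rightCts_paths] with ω h1 h2 h
    exact lt_passageTime h1 (h2 t) h
  · exact measureReal_mono fun ω h => le_of_lt_passageTime ht h

theorem measureReal_le_negLogOneSub [IsProbabilityMeasure P]
    (hL : IsLevySubordinator L P) (hQ : AEMeasurable Q P)
    (t : ℝ≥0) :
    P.real {ω | ((L t ω : ℝ) : EReal) ≤ negLogOneSub (Q ω)} =
      P.real {ω | ((L t ω : ℝ) : EReal) < negLogOneSub (Q ω)} +
        P.real {ω | ((L t ω : ℝ) : EReal) = negLogOneSub (Q ω)} := by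
  have hLt := hL.measurable t
  have hm : NullMeasurableSet {ω | ((L t ω : ℝ) : EReal) = negLogOneSub (Q ω)} P := by
    simp_rw [coe_eq_negLogOneSub_iff]
    exact nullMeasurableSet_eq_fun (by fun_prop) hQ
  have hdisj : Disjoint {ω | ((L t ω : ℝ) : EReal) < negLogOneSub (Q ω)}
      {ω | ((L t ω : ℝ) : EReal) = negLogOneSub (Q ω)} :=
    Set.disjoint_left.2 fun ω h1 h2 => (ne_of_lt h1) h2
  rw [← measureReal_union₀ hm hdisj.aedisjoint]
  congr 1
  ext ω
  exact le_iff_lt_or_eq (α := EReal)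

/-- By independence, conditioning on one of `L t` and `Q` asks the other, which has a density, to
take one given value. -/
theorem measureReal_eq_negLogOneSub_eq_zero [IsProbabilityMeasure P]
    (hL : IsLevySubordinator L P)
    (hQ : AEMeasurable Q P) (hQL : IndepFun Q (fun ω t => L t ω) P) {t : ℝ≥0}
    (h : HasPDF (L t) P volume ∨ HasPDF Q P volume) :
    P.real {ω | ((L t ω : ℝ) : EReal) = negLogOneSub (Q ω)} = 0 := by
  have hLt := (hL.measurable t).aemeasurable (μ := P)
  have hind : IndepFun Q (L t) P := hQL.comp measurable_id (measurable_pi_apply t)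
  simp_rw [coe_eq_negLogOneSub_iff]
  rcases h with h | h
  · have hA : MeasurableSet {p : ℝ × ℝ | 1 - Real.exp (-p.2) = p.1} :=
      measurableSet_eq_fun (by fun_prop) (by fun_prop)
    have := Measure.isProbabilityMeasure_map hLt
    refine (measureReal_mem_eq_integral_of_indepFun hLt hQ hind hA).trans
      (integral_eq_zero_of_ae (Eventually.of_forall fun ω => (measureReal_eq_zero_iff).2
        (h.absolutelyContinuous' (Set.Subsingleton.measure_zero (fun x hx y hy => ?_) _))))
    have hxy : 1 - Real.exp (-x) = 1 - Real.exp (-y) := Eq.trans hx (Eq.symm hy)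
    exact neg_injective (Real.exp_injective (sub_right_injective hxy))
  · have hA : MeasurableSet {p : ℝ × ℝ | 1 - Real.exp (-p.1) = p.2} :=
      measurableSet_eq_fun (by fun_prop) (by fun_prop)
    have := Measure.isProbabilityMeasure_map hQ
    refine (measureReal_mem_eq_integral_of_indepFun hQ hLt hind.symm hA).trans
      (integral_eq_zero_of_ae (Eventually.of_forall fun ω => (measureReal_eq_zero_iff).2
        (h.absolutelyContinuous' (Set.Subsingleton.measure_zero (fun x hx y hy => ?_) _))))
    exact Eq.trans (Eq.symm hx) hy

end Sandwich

theorem limsup_abs_sub_le_of_eventually {u : ℕ+ → ℝ} {lo d c : ℝ}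
    (hu : ∀ ε > 0, ∀ᶠ n in atTop, u n < lo + d + ε ∧ lo - ε < u n)
    (hc : c ∈ Set.Icc lo (lo + d)) : limsup (fun n => |u n - c|) atTop ≤ d := by
  refine le_of_forall_pos_le_add fun ε hε => ?_
  refine limsup_le_of_le (isCoboundedUnder_le_of_le atTop (x := 0) fun n => abs_nonneg _) ?_
  filter_upwards [hu ε hε] with n hn
  exact abs_le.2 ⟨by linarith [hc.2], by linarith [hc.1]⟩

theorem tendsto_of_eventually_lt {u : ℕ+ → ℝ} {c : ℝ}
    (hu : ∀ ε > 0, ∀ᶠ n in atTop, u n < c + ε ∧ c - ε < u n) : Tendsto u atTop (𝓝 c) := by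
  rw [Metric.tendsto_nhds]
  intro ε hε
  filter_upwards [hu ε hε] with n hn
  rw [Real.dist_eq, abs_lt]
  exact ⟨by linarith, by linarith⟩

theorem theorem1
    -- the subordinator and the limiting variable
    {Ω : Type*} [MeasurableSpace Ω] (P : Measure Ω) [IsProbabilityMeasure P]
    (L : ℝ≥0 → Ω → ℝ) (hL : IsLevySubordinator L P)
    (Q : Ω → ℝ) (hQL : IndepFun Q (fun ω t => L t ω) P)
    -- for each `n ≥ 1`, a mixed coherent system of size `n`
    {S : ℕ+ → Type*} [∀ n, MeasurableSpace (S n)]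
    (μ : ∀ n, Measure (S n)) [∀ n, IsProbabilityMeasure (μ n)]
    (Φ : ∀ n : ℕ+, S n → StructureFunction n)
    (hΦ : ∀ n, IsMixedCoherent (Φ n) (μ n))
    -- its components have failure times with the LFMO law driven by `L`
    (T : ∀ n : ℕ+, S n → Fin n → ℝ≥0∞)
    (hT : ∀ n : ℕ+, HasLaw (T n) (lfmoLaw L P n) (μ n))
    (hΦT : ∀ n, IndepFun (Φ n) (T n) (μ n))
    -- variables distributed according to the signatures
    {R : ℕ+ → Type*} [∀ n, MeasurableSpace (R n)]
    (ν : ∀ n, Measure (R n)) [∀ n, IsProbabilityMeasure (ν n)]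
    (Qn : ∀ n, R n → ℝ)
    (hQn : ∀ n : ℕ+, ∀ k ∈ Finset.Icc 1 (n : ℕ),
      (ν n).real {ω | Qn n ω = (k : ℝ) / ((n : ℝ) + 1)} = signature (Φ n) (μ n) k)
    -- the two hypotheses on the signatures
    (hA : TendstoInDistribution Qn atTop Q ν P)
    (hB : (fun n : ℕ+ => ∫ ω, 1 / √(Qn n ω * (1 - Qn n ω)) ∂(ν n))
      =o[atTop] (fun n : ℕ+ => √(n : ℝ))) :
    (∀ t : ℝ≥0, 0 < t →
      limsup (fun n : ℕ+ =>
          |(μ n).real {ω | (t : ℝ≥0∞) < systemFailureTime (Φ n ω) (T n ω)}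
            - P.real {ω | (t : ℝ≥0∞) < passageTime (fun u => L u ω) (negLogOneSub (Q ω))}|)
          atTop
        ≤ P.real {ω | ((L t ω : ℝ) : EReal) = negLogOneSub (Q ω)} ∧
      limsup (fun n : ℕ+ =>
          |(μ n).real {ω | (t : ℝ≥0∞) < systemFailureTime (Φ n ω) (T n ω)}
            - P.real {ω | ((L t ω : ℝ) : EReal) < negLogOneSub (Q ω)}|)
          atTop
        ≤ P.real {ω | ((L t ω : ℝ) : EReal) = negLogOneSub (Q ω)}) ∧
    (∀ t : ℝ≥0, 0 < t → (HasPDF (L t) P volume ∨ HasPDF Q P volume) →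
      Tendsto (fun n : ℕ+ =>
          (μ n).real {ω | (t : ℝ≥0∞) < systemFailureTime (Φ n ω) (T n ω)}) atTop
        (𝓝 (P.real {ω | (t : ℝ≥0∞) < passageTime (fun u => L u ω) (negLogOneSub (Q ω))})) ∧
      Tendsto (fun n : ℕ+ =>
          (μ n).real {ω | (t : ℝ≥0∞) < systemFailureTime (Φ n ω) (T n ω)}) atTop
        (𝓝 (P.real {ω | ((L t ω : ℝ) : EReal) < negLogOneSub (Q ω)}))) ∧
    (((∀ t : ℝ≥0, 0 < t → HasPDF (L t) P volume) ∨ HasPDF Q P volume) →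
      TendstoInDistribution (fun (n : ℕ+) ω => systemFailureTime (Φ n ω) (T n ω)) atTop
        (fun ω => passageTime (fun u => L u ω) (negLogOneSub (Q ω))) μ P) := by
  have hQ : AEMeasurable Q P := hA.aemeasurable_limit
  have hb : ∀ n : ℕ+, ∀ j ≤ (n : ℕ), workingProportion (Φ n) (μ n) j =
      ((ν n).map (Qn n)).real (Set.Ici (1 - (j : ℝ) / (((n : ℕ) : ℝ) + 1))) := by
    intro n j hj
    have := Measure.isProbabilityMeasure_map (hA.forall_aemeasurable n)
    refine eq_measureReal_Ici_of_increments ((hΦ n).workingProportion_zero n.pos)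
      ((hΦ n).workingProportion_self n.pos) (fun k hk => ?_) hj
    refine Eq.trans ?_ (hQn n k hk)
    rw [measureReal_def, Measure.map_apply_of_aemeasurable (hA.forall_aemeasurable n)
      (measurableSet_singleton _)]
    rfl
  have hev : ∀ t : ℝ≥0, ∀ ε > 0, ∀ᶠ n : ℕ+ in atTop,
      (μ n).real {ω | (t : ℝ≥0∞) < systemFailureTime (Φ n ω) (T n ω)} <
        P.real {ω | ((L t ω : ℝ) : EReal) < negLogOneSub (Q ω)} +
          P.real {ω | ((L t ω : ℝ) : EReal) = negLogOneSub (Q ω)} + ε ∧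
      P.real {ω | ((L t ω : ℝ) : EReal) < negLogOneSub (Q ω)} - ε <
        (μ n).real {ω | (t : ℝ≥0∞) < systemFailureTime (Φ n ω) (T n ω)} := by
    intro t ε hε
    have h := eventually_integral_binomialAverage hL hQ hQL hA.tendsto rfl hb t hε
    simp_rw [← coe_le_negLogOneSub_iff, ← coe_lt_negLogOneSub_iff,
      measureReal_le_negLogOneSub hL hQ t] at h
    filter_upwards [h] with n hn
    rwa [measureReal_lt_systemFailureTime hL (hΦ n) (hT n) (hΦT n) t]
  have hpass : ∀ t : ℝ≥0, 0 < t →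
      P.real {ω | (t : ℝ≥0∞) < passageTime (fun u => L u ω) (negLogOneSub (Q ω))} ∈
        Set.Icc (P.real {ω | ((L t ω : ℝ) : EReal) < negLogOneSub (Q ω)})
          (P.real {ω | ((L t ω : ℝ) : EReal) < negLogOneSub (Q ω)} +
            P.real {ω | ((L t ω : ℝ) : EReal) = negLogOneSub (Q ω)}) := by
    intro t ht
    rw [← measureReal_le_negLogOneSub hL hQ t]
    exact measureReal_lt_passageTime_mem_Icc hL ht
  have htend : ∀ t : ℝ≥0, 0 < t → (HasPDF (L t) P volume ∨ HasPDF Q P volume) →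
      Tendsto (fun n : ℕ+ =>
          (μ n).real {ω | (t : ℝ≥0∞) < systemFailureTime (Φ n ω) (T n ω)}) atTop
        (𝓝 (P.real {ω | (t : ℝ≥0∞) < passageTime (fun u => L u ω) (negLogOneSub (Q ω))})) ∧
      Tendsto (fun n : ℕ+ =>
          (μ n).real {ω | (t : ℝ≥0∞) < systemFailureTime (Φ n ω) (T n ω)}) atTop
        (𝓝 (P.real {ω | ((L t ω : ℝ) : EReal) < negLogOneSub (Q ω)})) := by
    intro t ht hpdf
    have h0 := measureReal_eq_negLogOneSub_eq_zero hL hQ hQL hpdf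
    have h1 := hpass t ht
    have h2 := hev t
    rw [h0, add_zero, Set.Icc_self, Set.mem_singleton_iff] at h1
    rw [h0, add_zero] at h2
    rw [h1, and_self]
    exact tendsto_of_eventually_lt h2
  refine ⟨fun t ht => ⟨limsup_abs_sub_le_of_eventually (hev t) (hpass t ht),
    limsup_abs_sub_le_of_eventually (hev t) ⟨le_rfl, le_add_of_nonneg_right measureReal_nonneg⟩⟩,
    htend, fun hpdf => ?_⟩
  have hS : ∀ n : ℕ+, AEMeasurable (fun ω => systemFailureTime (Φ n ω) (T n ω)) (μ n) :=
    fun n => aemeasurable_systemFailureTime (hΦ n) (hT n).aemeasurable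
  have hτ := aemeasurable_passageTime hL hQ
  refine ⟨hS, hτ, tendsto_probabilityMeasure_of_tendsto_Ioi fun t ht => ?_⟩
  have h := (htend t ht (hpdf.imp_left fun h => h t ht)).1
  simp only [ProbabilityMeasure.coe_mk, measureReal_def,
    Measure.map_apply_of_aemeasurable (hS _) measurableSet_Ioi,
    Measure.map_apply_of_aemeasurable hτ measurableSet_Ioi]
  exact h
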